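/- Let $\omega_0$ and $\omega_1$ carry the discrete topology, let $\beta\omega_0$ and $\beta\omega_1$ be their Čech–Stone compactifications with remainders $\omega_i^*=\beta\omega_i\setminus\omega_i$, and let $\omega_0+1$ and $\omega_1+1$ denote the one-point compactifications of these discrete spaces, with points at infinity $\omega_0$ and $\omega_1$, respectively. Put $$\mathbb J=\bigl((\omega_1+1)\times(\omega_0+1)\bigr)\setminus\{(\omega_1,\omega_0)\},\qquad \mathbb V=(\beta\omega_1\times\beta\omega_0)\setminus(\omega_1^*\times\omega_0^*),$$ with the subspace topologies. A space is realcompact if it is homeomorphic to a closed subspace of a power of $\mathbb R$. A perfect map is a continuous closed map with compact fibres whose domain is Hausdorff; a continuous surjection is irreducible if it maps no proper closed subset of its domain onto its codomain. An absolute of a space $Y$ is an extremally disconnected Tychonoff space $X$ together with a perfect irreducible map from $X$ onto $Y$. The natural maps $\beta\omega_1\to\omega_1+1$ and $\beta\omega_0\to\omega_0+1$ (the continuous extensions of the inclusions of $\omega_1$ and $\omega_0$) are perfect and irreducible, and so is their product $\pi:\beta\omega_1\times\beta\omega_0\to(\omega_1+1)\times(\omega_0+1)$; in particular these maps are onto.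 Both $\mathbb V$ and $\mathbb J$ are Tychonoff, $\mathbb V$ is realcompact and $\mathbb J$ is not. Moreover $\pi^{-1}[\mathbb J]=\mathbb V$, and $\pi$ restricts to a perfect map $f$ from $\mathbb V$ onto $\mathbb J$. Consequently perfect surjections between Tychonoff spaces need not preserve realcompactness. Finally, $\mathbb V$ is extremally disconnected and, with the map $f$, it is the absolute of $\mathbb J$: $(\mathbb V,f)$ is an absolute of $\mathbb J$, and for every absolute $(Z,g)$ of $\mathbb J$ there is a homeomorphism $h:\mathbb V\to Z$ with $g\circ h=f$. -/

import Mathlib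

universe u v

/-- A space is realcompact if it can be embedded as a closed subset in a power of the real line.
Index sets in the universe of `X` suffice: one may always take `ι` to be the set of continuous
real-valued functions on `X`. -/
def IsRealcompact (X : Type u) [TopologicalSpace X] : Prop :=
  ∃ (ι : Type u) (e : X → (ι → ℝ)), Topology.IsClosedEmbedding e

/-- A perfect map: a continuous closed map with compact fibres, defined on a Hausdorff space.
Surjectivity is not part of the definition. -/
structure IsPerfectMap {X : Type u} {Y : Type v} [TopologicalSpace X] [TopologicalSpace Y]
    (f : X → Y) : Prop where
  t2 : T2Space X
  continuous : Continuous f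
  isClosedMap : IsClosedMap f
  isCompact_fiber : ∀ y, IsCompact (f ⁻¹' {y})

/-- An irreducible map: a continuous surjection that maps no proper closed subset of its domain
onto its codomain. -/
structure IsIrreducibleMap {X : Type u} {Y : Type v} [TopologicalSpace X] [TopologicalSpace Y]
    (f : X → Y) : Prop where
  continuous : Continuous f
  surjective : Function.Surjective f
  image_ne_univ : ∀ A : Set X, IsClosed A → A ≠ Set.univ → f '' A ≠ Set.univ

/-- `f : X → Y` exhibits `X` as the absolute of `Y`: the space `X` is Tychonoff and
extremally disconnected, and `f` is a perfect irreducible map from `X` onto `Y`. -/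
structure IsAbsolute {X : Type u} {Y : Type v} [TopologicalSpace X] [TopologicalSpace Y]
    (f : X → Y) : Prop where
  tychonoff : T35Space X
  extremallyDisconnected : ExtremallyDisconnected X
  perfect : IsPerfectMap f
  irreducible : IsIrreducibleMap f

/-- The set `ω₁` of countable ordinals. -/
def OmegaOne : Type := (Ordinal.omega.{0} 1).ToType

/-- `ω₁` carries the discrete topology. -/
instance : TopologicalSpace OmegaOne := ⊥

instance : DiscreteTopology OmegaOne := ⟨rfl⟩

/-- For a discrete space `D`, the natural map from the Čech–Stone compactification `βD` to the
one-point compactification of `D`: the continuous extension of the inclusion of `D`. -/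
noncomputable def naturalMap (D : Type u) [TopologicalSpace D] [DiscreteTopology D] :
    StoneCech D → OnePoint D :=
  stoneCechExtend (g := ((↑) : D → OnePoint D)) OnePoint.continuous_coe

/-- The natural product map `βω₁ × βω₀ → (ω₁ + 1) × (ω₀ + 1)`, where `ω₀` is the discrete space `ℕ`
and `ω₁ + 1`, `ω₀ + 1` are the one-point compactifications of the discrete spaces `ω₁`, `ω₀`. -/
noncomputable def productMap : StoneCech OmegaOne × StoneCech ℕ → OnePoint OmegaOne × OnePoint ℕ :=
  Prod.map (naturalMap OmegaOne) (naturalMap ℕ)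

/-- The plank `𝕁 = (ω₁ + 1) × (ω₀ + 1) \ {(ω₁, ω₀)}`; each last point is the point at infinity. -/
def plankJ : Set (OnePoint OmegaOne × OnePoint ℕ) :=
  {(OnePoint.infty, OnePoint.infty)}ᶜ

/-- The remainder `D* = βD \ D`. -/
def remainder (D : Type u) [TopologicalSpace D] : Set (StoneCech D) :=
  (Set.range (stoneCechUnit : D → StoneCech D))ᶜ

/-- The plank `𝕍 = (βω₁ × βω₀) \ (ω₁* × ω₀*)`. -/
def plankV : Set (StoneCech OmegaOne × StoneCech ℕ) :=
  (remainder OmegaOne ×ˢ remainder ℕ)ᶜ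

/-! Realcompactness of `plankV`: a point outside it has both coordinates in remainders. Since ω₁ and
ω₀ inject into [0,1], each coordinate is a zero of a nonnegative continuous function that is
positive on the discrete part (`exists_zero_of_mem_remainder`). The sum of the two vanishes at the
point but nowhere on `plankV`, and its reciprocal keeps the point away from the image in ℝ^C(V)
(`isRealcompact_of_exists_zero`).

Failure for `plankJ`: continuity at (∞, n) makes F(·, n) constant off a countable set, so some a ∈
ω₁ satisfies F(a, n) = F(∞, n) for all n. Hence F(∞, n) → F(a, ∞) for every continuous F, although
(∞, n) tends to the missing corner (`exists_tendsto_of_continuous_plankJ`).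

Absolute: `plankV` is covered by open copies of βω₀ and βω₁, and the dense set ω₁ × ω₀ of isolated
points has singleton fibres. Every absolute of `plankJ` contains such a dense copy of ω₁ × ω₀; the
closure of the matching pairs in the product of two absolutes is the graph of a homeomorphism
(`exists_homeomorph_of_dense_isolated`). -/

open Set Filter Topology

/-! ### Irreducible maps, uniqueness of absolutes, and a criterion for realcompactness. -/

section General

/-- A continuous surjection whose fibres over the image of a dense set are singletons is
irreducible. -/
theorem IsIrreducibleMap.of_denseRange {X Y D : Type*} [TopologicalSpace X] [TopologicalSpace Y]
    {f : X → Y} {i : D → X} (hf : Continuous f) (hs : Function.Surjective f) (hi : DenseRange i)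
    (hfib : ∀ d x, f x = f (i d) → x = i d) : IsIrreducibleMap f where
  continuous := hf
  surjective := hs
  image_ne_univ A hA hne h := by
    refine hne (eq_univ_of_univ_subset ?_)
    rw [← hi.closure_range]
    refine closure_minimal ?_ hA
    rintro _ ⟨d, rfl⟩
    obtain ⟨x, hx, hxd⟩ : f (i d) ∈ f '' A := h ▸ mem_univ _
    exact hfib d x hxd ▸ hx

theorem IsPerfectMap.isProperMap {X Y : Type*} [TopologicalSpace X] [TopologicalSpace Y]
    {f : X → Y} (hf : IsPerfectMap f) : IsProperMap f :=
  isProperMap_iff_isClosedMap_and_compact_fibers.2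
    ⟨hf.continuous, hf.isClosedMap, hf.isCompact_fiber⟩

theorem IsProperMap.isPerfectMap {X Y : Type*} [TopologicalSpace X] [TopologicalSpace Y]
    [T2Space X] {f : X → Y} (hf : IsProperMap f) : IsPerfectMap f :=
  ⟨inferInstance, hf.continuous, hf.isClosedMap,
    (isProperMap_iff_isClosedMap_and_compact_fibers.1 hf).2.2⟩

/-- Extremal disconnectedness is a local property. -/
theorem ExtremallyDisconnected.of_isOpenEmbedding {X : Type*} [TopologicalSpace X]
    (h : ∀ x : X, ∃ (E : Type) (_ : TopologicalSpace E) (_ : ExtremallyDisconnected E)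
      (φ : E → X), IsOpenEmbedding φ ∧ x ∈ range φ) : ExtremallyDisconnected X where
  open_closure U hU := by
    refine isOpen_iff_mem_nhds.2 fun x hx => ?_
    obtain ⟨E, _, _, φ, hφ, y, rfl⟩ := h x
    have hpre := hφ.isOpenMap.preimage_closure_eq_closure_preimage hφ.continuous U
    have ho : IsOpen (φ ⁻¹' closure U) :=
      hpre ▸ ExtremallyDisconnected.open_closure _ (hU.preimage hφ.continuous)
    exact mem_of_superset ((hφ.isOpenMap _ ho).mem_nhds ⟨y, hx, rfl⟩) (image_preimage_subset _ _)

/-- If `X` is extremally disconnected with isolated points `i d`, then the closure of the set of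
the pairs `(i d, j d)` in `X × Z` is the graph of a partial function. -/
theorem eq_of_mem_closure_range_prod {X Z D : Type*} [TopologicalSpace X] [TopologicalSpace Z]
    [ExtremallyDisconnected X] [T2Space Z] {i : D → X} {j : D → Z}
    (hi : ∀ d, IsOpen {i d}) (hinj : Function.Injective i) {x : X} {z₁ z₂ : Z}
    (h₁ : (x, z₁) ∈ closure (range fun d => (i d, j d)))
    (h₂ : (x, z₂) ∈ closure (range fun d => (i d, j d))) : z₁ = z₂ := by
  by_contra hne
  obtain ⟨W₁, W₂, hW₁, hW₂, hz₁, hz₂, hW⟩ := t2_separation hne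
  have hopen : ∀ S : Set D, IsOpen (i '' S) := fun S => by
    rw [image_eq_iUnion]
    exact isOpen_biUnion fun d _ => hi d
  have hmem : ∀ {W : Set Z} {z : Z}, IsOpen W → z ∈ W →
      (x, z) ∈ closure (range fun d => (i d, j d)) → x ∈ closure (i '' (j ⁻¹' W)) := by
    intro W z hWo hz h
    refine mem_closure_iff.2 fun N hN hx => ?_
    obtain ⟨_, ⟨hdN, hdW⟩, d, rfl⟩ := mem_closure_iff.1 h _ (hN.prod hWo) ⟨hx, hz⟩
    exact ⟨i d, hdN, d, hdW, rfl⟩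
  -- Disjoint open sets in an extremally disconnected space have disjoint closures, yet `x` would
  -- lie in both.
  have hdisj : Disjoint (i '' (j ⁻¹' W₁)) (i '' (j ⁻¹' W₂)) :=
    (disjoint_image_iff hinj).2 (hW.preimage j)
  exact disjoint_left.1 (ExtremallyDisconnected.disjoint_closure_of_disjoint_isOpen hdisj
    (hopen _) (hopen _)) (hmem hW₁ hz₁ h₁) (hmem hW₂ hz₂ h₂)

/-- The closure lies in the fibre product of `f` and `g`, so properness of `g` makes the projection
proper. Its closed image contains a dense set, and extremal disconnectedness of `X` gives
injectivity. -/
theorem isHomeomorph_fst_closure_range_prod {X Y Z D : Type*} [TopologicalSpace X]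
    [TopologicalSpace Y] [TopologicalSpace Z] [T2Space Y] [T2Space X] [T2Space Z]
    [ExtremallyDisconnected X] {f : X → Y} {g : Z → Y} (hf : Continuous f) (hg : IsProperMap g)
    {i : D → X} {j : D → Z} (hi : ∀ d, IsOpen {i d}) (hinj : Function.Injective i)
    (hdense : DenseRange i) (hfg : ∀ d, f (i d) = g (j d)) :
    IsHomeomorph (fun m : closure (range fun d => (i d, j d)) => m.1.1) := by
  have hM : ∀ m ∈ closure (range fun d => (i d, j d)), f m.1 = g m.2 := by
    intro m hm
    refine closure_minimal ?_ (isClosed_eq (hf.comp continuous_fst)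
      (hg.continuous.comp continuous_snd)) hm
    rintro _ ⟨d, rfl⟩
    exact hfg d
  have hproper : IsProperMap (fun m : closure (range fun d => (i d, j d)) => m.1.1) := by
    refine isProperMap_iff_ultrafilter.2
      ⟨continuous_fst.comp continuous_subtype_val, fun U x hU => ?_⟩
    have hlim : Tendsto g (U.map fun m => m.1.2 : Ultrafilter Z) (𝓝 (f x)) := by
      have : Tendsto (fun m : closure (range fun d => (i d, j d)) => g m.1.2) U (𝓝 (f x)) :=
        ((hf.tendsto x).comp hU).congr fun m => hM m.1 m.2
      exact this
    -- Properness of `g` supplies the limit of the second coordinates.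
    obtain ⟨z, -, hz⟩ := (isProperMap_iff_ultrafilter.1 hg).2 hlim
    have hval : Tendsto (fun m : closure (range fun d => (i d, j d)) => m.1) U (𝓝 (x, z)) :=
      Tendsto.prodMk_nhds hU hz
    have hmem : (x, z) ∈ closure (range fun d => (i d, j d)) :=
      isClosed_closure.mem_of_tendsto hval (Eventually.of_forall fun m => m.2)
    exact ⟨⟨(x, z), hmem⟩, rfl, (tendsto_subtype_rng (f := id)).2 hval⟩
  refine isHomeomorph_iff_continuous_isClosedMap_bijective.2
    ⟨hproper.continuous, hproper.isClosedMap, ?_, ?_⟩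
  · rintro ⟨⟨x, z₁⟩, h₁⟩ ⟨⟨x', z₂⟩, h₂⟩ (rfl : x = x')
    obtain rfl := eq_of_mem_closure_range_prod hi hinj h₁ h₂
    rfl
  · refine range_eq_univ.1 (eq_univ_of_univ_subset ?_)
    rw [← hdense.closure_range]
    refine closure_minimal ?_ hproper.isClosedMap.isClosed_range
    rintro _ ⟨d, rfl⟩
    exact ⟨⟨(i d, j d), subset_closure ⟨d, rfl⟩⟩, rfl⟩

/-- Two extremally disconnected spaces that are mapped properly to the same space are homeomorphic
over it if they share a dense set of isolated points. -/
theorem exists_homeomorph_of_dense_isolated {X Y Z D : Type*} [TopologicalSpace X]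
    [TopologicalSpace Y] [TopologicalSpace Z] [T2Space Y] [T2Space X] [T2Space Z]
    [ExtremallyDisconnected X] [ExtremallyDisconnected Z] {f : X → Y} {g : Z → Y}
    (hf : IsProperMap f) (hg : IsProperMap g) {i : D → X} {j : D → Z}
    (hi : ∀ d, IsOpen {i d}) (hj : ∀ d, IsOpen {j d}) (hiinj : Function.Injective i)
    (hjinj : Function.Injective j) (hidense : DenseRange i) (hjdense : DenseRange j)
    (hfg : ∀ d, f (i d) = g (j d)) : ∃ h : X ≃ₜ Z, ∀ x, g (h x) = f x := by
  let e₁ := (isHomeomorph_fst_closure_range_prod hf.continuous hg hi hiinj hidense hfg).homeomorph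
  let e₂ := (isHomeomorph_fst_closure_range_prod hg.continuous hf hj hjinj hjdense
    fun d => (hfg d).symm).homeomorph
  have himg : Prod.swap ⁻¹' closure (range fun d => (j d, i d)) =
      closure (range fun d => (i d, j d)) := by
    have := (Homeomorph.prodComm X Z).preimage_closure (range fun d => (j d, i d))
    refine this.trans (congrArg closure ?_)
    ext ⟨x, z⟩
    simp [and_comm]
  let s : closure (range fun d => (i d, j d)) ≃ₜ closure (range fun d => (j d, i d)) :=
    (Homeomorph.prodComm X Z).subtype fun m => by
      rw [← himg]
      rfl
  let h := (e₁.symm.trans s).trans e₂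
  refine ⟨h, hidense.equalizer (hg.continuous.comp h.continuous) hf.continuous ?_ |> congrFun⟩
  funext d
  have hsymm : e₁.symm (i d) = ⟨(i d, j d), subset_closure ⟨d, rfl⟩⟩ :=
    e₁.symm_apply_eq.2 rfl
  have hval : h (i d) = j d := by
    change e₂ (s (e₁.symm (i d))) = j d
    rw [hsymm]
    rfl
  simp [hval, hfg]

/-- The fibre of a perfect irreducible map over an isolated point is an isolated point. -/
theorem IsIrreducibleMap.exists_fiber_eq_singleton {Z Y : Type*} [TopologicalSpace Z] [T1Space Z]
    [TopologicalSpace Y] {g : Z → Y} (hg : IsIrreducibleMap g) {y : Y} (hy : IsOpen {y}) :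
    ∃ z, g ⁻¹' {y} = {z} := by
  obtain ⟨z, hz⟩ := hg.surjective y
  refine ⟨z, Subset.antisymm (fun w hw => ?_) (by simpa using hz)⟩
  by_contra hwz
  -- Removing the rest of the fibre leaves a closed set that still maps onto `Y`; it is proper if
  -- the fibre has a second point.
  have ho : IsOpen (g ⁻¹' {y} ∩ {z}ᶜ) := (hy.preimage hg.continuous).inter isOpen_compl_singleton
  refine hg.image_ne_univ _ ho.isClosed_compl
    (fun h => (h ▸ mem_univ w : w ∈ (g ⁻¹' {y} ∩ {z}ᶜ)ᶜ) ⟨hw, hwz⟩) (eq_univ_of_forall fun t => ?_)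
  by_cases ht : t = y
  · exact ⟨z, fun h => h.2 rfl, hz.trans ht.symm⟩
  · obtain ⟨w', rfl⟩ := hg.surjective t
    exact ⟨w', fun h => ht h.1, rfl⟩

/-- Isolated points lift uniquely. The closure of the lifts has a closed image containing a dense
set, so it maps onto `Y` and irreducibility makes it everything. -/
theorem IsAbsolute.exists_dense_isolated {Y Z D : Type*} [TopologicalSpace Y]
    [TopologicalSpace Z] {g : Z → Y} (hg : IsAbsolute g) {k : D → Y} (hk : ∀ d, IsOpen {k d})
    (hkinj : Function.Injective k) (hkdense : DenseRange k) :
    ∃ j : D → Z, (∀ d, IsOpen {j d}) ∧ Function.Injective j ∧ DenseRange j ∧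
      ∀ d, g (j d) = k d := by
  have := hg.perfect.t2
  choose j hj using fun d => hg.irreducible.exists_fiber_eq_singleton (hk d)
  have hgj : ∀ d, g (j d) = k d := fun d => (hj d ▸ rfl : j d ∈ g ⁻¹' {k d})
  refine ⟨j, fun d => hj d ▸ (hk d).preimage hg.perfect.continuous, ?_, ?_, hgj⟩
  · intro a b hab
    exact hkinj (by rw [← hgj, ← hgj, hab])
  · by_contra hd
    refine hg.irreducible.image_ne_univ _ isClosed_closure
      (fun h => hd (dense_iff_closure_eq.2 h)) (eq_univ_of_univ_subset ?_)
    rw [← hkdense.closure_range]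
    refine closure_minimal ?_ (hg.perfect.isClosedMap _ isClosed_closure)
    rintro _ ⟨d, rfl⟩
    exact ⟨j d, subset_closure ⟨d, rfl⟩, hgj d⟩

/-- Two absolutes of a Hausdorff space with a dense set of isolated points are homeomorphic
over it. -/
theorem IsAbsolute.exists_homeomorph {X Y Z D : Type*} [TopologicalSpace X]
    [TopologicalSpace Y] [TopologicalSpace Z] [T2Space Y] {f : X → Y} {g : Z → Y}
    (hf : IsAbsolute f) (hg : IsAbsolute g) {k : D → Y} (hk : ∀ d, IsOpen {k d})
    (hkinj : Function.Injective k) (hkdense : DenseRange k) :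
    ∃ h : X ≃ₜ Z, ∀ x, g (h x) = f x := by
  have := hf.perfect.t2
  have := hg.perfect.t2
  have := hf.extremallyDisconnected
  have := hg.extremallyDisconnected
  obtain ⟨i, hi, hiinj, hidense, hfi⟩ := hf.exists_dense_isolated hk hkinj hkdense
  obtain ⟨j, hj, hjinj, hjdense, hgj⟩ := hg.exists_dense_isolated hk hkinj hkdense
  exact exists_homeomorph_of_dense_isolated hf.perfect.isProperMap hg.perfect.isProperMap
    hi hj hiinj hjinj hidense hjdense fun d => (hfi d).trans (hgj d).symm

/-- A subspace of a compact Hausdorff space is realcompact if every point outside it is a zero of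
a continuous function without zeros on the subspace. -/
theorem isRealcompact_of_exists_zero {K : Type*} [TopologicalSpace K] [CompactSpace K] [T2Space K]
    {V : Set K} (h : ∀ p ∉ V, ∃ H : K → ℝ, Continuous H ∧ H p = 0 ∧ ∀ v ∈ V, H v ≠ 0) :
    IsRealcompact V := by
  let e : V → (C(V, ℝ) → ℝ) := fun v F => F v
  have he : Continuous e := continuous_pi fun F => F.continuous
  have hinj : Function.Injective e := by
    intro v w hvw
    by_contra hne
    obtain ⟨F, hF, hFv, hFw⟩ := CompletelyRegularSpace.completely_regular v {w}
      isClosed_singleton hne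
    have h1 := congrFun hvw ⟨fun x => (F x : ℝ), continuous_subtype_val.comp hF⟩
    have h2 : F v = F w := Subtype.ext h1
    rw [hFv, hFw rfl] at h2
    exact zero_ne_one h2
  have hproper : IsProperMap e := by
    refine isProperMap_iff_ultrafilter.2 ⟨he, fun U z hU => ?_⟩
    let p := (U.map Subtype.val : Ultrafilter K).lim
    have hp : Tendsto (Subtype.val : V → K) U (𝓝 p) :=
      (U.map Subtype.val : Ultrafilter K).le_nhds_lim
    by_cases hpV : p ∈ V
    · have hlim : (U : Filter V) ≤ 𝓝 ⟨p, hpV⟩ := (tendsto_subtype_rng (f := id)).2 hp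
      exact ⟨⟨p, hpV⟩, tendsto_nhds_unique (he.tendsto _ |>.mono_left hlim) hU, hlim⟩
    · obtain ⟨H, hH, hHp, hHV⟩ := h p hpV
      -- The coordinate 1/H converges along `U` while H tends to 0, so their product, constantly 1,
      -- would tend to 0.
      let F : C(V, ℝ) := ⟨fun v => (H v)⁻¹,
        (hH.comp continuous_subtype_val).inv₀ fun v => hHV v v.2⟩
      have h1 : Tendsto (fun v : V => H v * (H v)⁻¹) U (𝓝 (H p * z F)) :=
        ((hH.tendsto p).comp hp).mul (tendsto_pi_nhds.1 hU F)
      have h2 : Tendsto (fun v : V => H v * (H v)⁻¹) U (𝓝 1) :=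
        tendsto_const_nhds.congr fun v => (mul_inv_cancel₀ (hHV v v.2)).symm
      have h3 := tendsto_nhds_unique h1 h2
      rw [hHp, zero_mul] at h3
      exact absurd h3 zero_ne_one
  exact ⟨C(V, ℝ), e, .of_continuous_injective_isClosedMap he hinj hproper.isClosedMap⟩

end General

/-! ### Compactifications of a discrete space. -/

section Discrete

variable {D : Type u} [TopologicalSpace D] [DiscreteTopology D]

theorem continuous_naturalMap : Continuous (naturalMap D) :=
  continuous_stoneCechExtend _

@[simp]
theorem naturalMap_stoneCechUnit (d : D) : naturalMap D (stoneCechUnit d) = d :=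
  stoneCechExtend_stoneCechUnit _ d

theorem isOpen_singleton_coe_onePoint (d : D) : IsOpen {(d : OnePoint D)} := by
  simpa using OnePoint.isOpenEmbedding_coe.isOpenMap {d} (isOpen_discrete _)

/-- The preimage is open, so it lies in the closure of its trace on the dense set `D`, which is a
single point. -/
theorem naturalMap_preimage_coe (d : D) :
    naturalMap D ⁻¹' {(d : OnePoint D)} = {stoneCechUnit d} := by
  have ho := (isOpen_singleton_coe_onePoint d).preimage (continuous_naturalMap (D := D))
  refine Subset.antisymm ?_ (by simp)
  refine (denseRange_stoneCechUnit.open_subset_closure_inter ho).trans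
    (closure_minimal ?_ isClosed_singleton)
  rintro _ ⟨hc, c, rfl⟩
  simpa using congrArg stoneCechUnit (OnePoint.coe_injective (by simpa using hc))

theorem naturalMap_eq_coe_iff {d : D} {x : StoneCech D} :
    naturalMap D x = d ↔ x = stoneCechUnit d := by
  simpa [Set.ext_iff] using Set.ext_iff.1 (naturalMap_preimage_coe d) x

theorem isOpen_singleton_stoneCechUnit (d : D) : IsOpen {(stoneCechUnit d : StoneCech D)} :=
  naturalMap_preimage_coe d ▸ (isOpen_singleton_coe_onePoint d).preimage continuous_naturalMap

theorem naturalMap_eq_infty_iff {x : StoneCech D} :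
    naturalMap D x = OnePoint.infty ↔ x ∈ remainder D := by
  constructor
  · rintro hx ⟨d, rfl⟩
    simp at hx
  · intro hx
    induction h : naturalMap D x using OnePoint.rec with
    | infty => rfl
    | coe d => exact absurd ⟨d, (naturalMap_eq_coe_iff.1 h).symm⟩ hx

theorem naturalMap_surjective [Infinite D] : Function.Surjective (naturalMap D) := by
  refine range_eq_univ.1 (eq_univ_of_univ_subset ?_)
  have : NoncompactSpace D :=
    not_compactSpace_iff.1 fun _ => not_finite_iff_infinite.2 ‹_› finite_of_compact_of_discrete
  rw [← (OnePoint.denseRange_coe : DenseRange ((↑) : D → OnePoint D)).closure_range]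
  refine closure_minimal ?_ continuous_naturalMap.isClosedMap.isClosed_range
  rintro _ ⟨d, rfl⟩
  exact ⟨stoneCechUnit d, by simp⟩

theorem isIrreducibleMap_naturalMap [Infinite D] : IsIrreducibleMap (naturalMap D) :=
  .of_denseRange continuous_naturalMap naturalMap_surjective denseRange_stoneCechUnit
    fun d x h => naturalMap_eq_coe_iff.1 (by simpa using h)

theorem extremallyDisconnected_stoneCech : ExtremallyDisconnected (StoneCech D) :=
  StoneCech.projective.extremallyDisconnected

/-- Since `D` is not larger than the continuum, every point of its remainder is a zero of a
continuous function that is positive on `D`. -/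
theorem exists_zero_of_mem_remainder {g : D → unitInterval} (hg : Function.Injective g)
    {x : StoneCech D} (hx : x ∈ remainder D) :
    ∃ h : StoneCech D → ℝ, Continuous h ∧ h x = 0 ∧ (∀ y, 0 ≤ h y) ∧
      ∀ d, 0 < h (stoneCechUnit d) := by
  let G : StoneCech D → unitInterval := stoneCechExtend (g := g) continuous_of_discreteTopology
  have hG : Continuous G := continuous_stoneCechExtend _
  -- The distance from `G` to `G x` can vanish on `D` at no more than one point, by injectivity of
  -- `g`. That point is isolated, so adding the indicator of `S` repairs positivity there without
  -- losing continuity or the zero at `x`.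
  let S : Set (StoneCech D) := stoneCechUnit '' {d | g d = G x}
  have hS : IsClopen S := by
    constructor
    · refine Set.Finite.isClosed (Set.Finite.image _ (Set.Subsingleton.finite ?_))
      intro a ha b hb
      exact hg (ha.trans hb.symm)
    · simp only [S, image_eq_iUnion]
      exact isOpen_biUnion fun d _ => isOpen_singleton_stoneCechUnit d
  have hnonneg : ∀ y, 0 ≤ S.indicator (fun _ => (1 : ℝ)) y :=
    fun y => indicator_nonneg (fun _ _ => zero_le_one) y
  refine ⟨fun y => dist (G y) (G x) + S.indicator (fun _ => 1) y,
    (hG.dist continuous_const).add (continuous_const.indicator fun y hy => by simp [hS.frontier_eq] at hy), ?_,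
    fun y => add_nonneg dist_nonneg (hnonneg y), fun d => ?_⟩
  · have : x ∉ S := by
      rintro ⟨d, -, rfl⟩
      exact hx ⟨d, rfl⟩
    simp [this]
  · have hGd : G (stoneCechUnit d) = g d := stoneCechExtend_stoneCechUnit _ d
    by_cases hd : g d = G x
    · have : stoneCechUnit d ∈ S := ⟨d, hd, rfl⟩
      simp only [indicator_of_mem this]
      positivity
    · exact add_pos_of_pos_of_nonneg (dist_pos.2 (hGd ▸ hd)) (hnonneg _)

theorem tendsto_coe_onePoint_cofinite :
    Tendsto ((↑) : D → OnePoint D) cofinite (𝓝 OnePoint.infty) := by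
  have := OnePoint.tendsto_coe_infty (X := D)
  rwa [coclosedCompact_eq_cocompact, cocompact_eq_cofinite] at this

/-- Each neighbourhood of f(∞) contains all but finitely many values, and countably many
neighbourhoods in ℝ shrink to the point. -/
theorem countable_setOf_ne_infty {f : OnePoint D → ℝ} (hf : Continuous f) :
    {d : D | f d ≠ f OnePoint.infty}.Countable := by
  have := ((hf.tendsto OnePoint.infty).comp
    tendsto_coe_onePoint_cofinite).countable_compl_preimage_ker
  rw [ker_nhds] at this
  exact this

end Discrete

theorem mk_omegaOne : Cardinal.mk OmegaOne = Cardinal.aleph 1 := by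
  simp [OmegaOne]

instance : Uncountable OmegaOne := by
  rw [← Cardinal.aleph0_lt_mk_iff, mk_omegaOne]
  exact Cardinal.aleph0_lt_aleph_one

theorem exists_injective_unitInterval {D : Type} (h : Cardinal.mk D ≤ Cardinal.continuum) :
    ∃ g : D → unitInterval, Function.Injective g := by
  rw [← Cardinal.mk_Icc_real zero_lt_one] at h
  obtain ⟨g⟩ := Cardinal.le_def _ _ |>.1 h
  exact ⟨g, g.injective⟩

/-! ### The two planks and the map between them. -/

section Planks

theorem continuous_productMap : Continuous productMap :=
  continuous_naturalMap.prodMap continuous_naturalMap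

theorem productMap_surjective : Function.Surjective productMap :=
  naturalMap_surjective.prodMap naturalMap_surjective

theorem denseRange_unit_prod :
    DenseRange (Prod.map stoneCechUnit stoneCechUnit :
      OmegaOne × ℕ → StoneCech OmegaOne × StoneCech ℕ) :=
  denseRange_stoneCechUnit.prodMap denseRange_stoneCechUnit

theorem eq_of_productMap_eq (d : OmegaOne × ℕ) (x : StoneCech OmegaOne × StoneCech ℕ)
    (h : productMap x = productMap (Prod.map stoneCechUnit stoneCechUnit d)) :
    x = Prod.map stoneCechUnit stoneCechUnit d := by
  obtain ⟨h1, h2⟩ := Prod.ext_iff.1 h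
  simp only [productMap, Prod.map_fst, Prod.map_snd, naturalMap_stoneCechUnit,
    naturalMap_eq_coe_iff] at h1 h2
  exact Prod.ext h1 h2

theorem productMap_preimage_plankJ : productMap ⁻¹' plankJ = plankV := by
  ext ⟨x, y⟩
  simp [plankJ, plankV, productMap, naturalMap_eq_infty_iff]

theorem isRealcompact_plankV : IsRealcompact plankV := by
  obtain ⟨g, hg⟩ := exists_injective_unitInterval
    (mk_omegaOne.trans_le Cardinal.aleph_one_le_continuum)
  obtain ⟨g', hg'⟩ := exists_injective_unitInterval (D := ℕ)
    (Cardinal.mk_nat.trans_le Cardinal.aleph0_le_continuum)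
  refine isRealcompact_of_exists_zero fun p hp => ?_
  obtain ⟨hp1, hp2⟩ := not_not.1 hp
  obtain ⟨h, hc, h0, hnn, hpos⟩ := exists_zero_of_mem_remainder hg hp1
  obtain ⟨h', hc', h0', hnn', hpos'⟩ := exists_zero_of_mem_remainder hg' hp2
  refine ⟨fun q => h q.1 + h' q.2, by fun_prop, by simp [h0, h0'], ?_⟩
  rintro ⟨x, y⟩ hv
  have hv' : x ∈ range stoneCechUnit ∨ y ∈ range stoneCechUnit := by
    simpa only [plankV, remainder, mem_compl_iff, mem_prod, not_and_or, not_not] using hv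
  rcases hv' with ⟨a, rfl⟩ | ⟨n, rfl⟩
  · exact (add_pos_of_pos_of_nonneg (hpos a) (hnn' y)).ne'
  · exact (add_pos_of_nonneg_of_pos (hnn x) (hpos' n)).ne'

theorem mk_coe_mem_plankJ (x : OnePoint OmegaOne) (n : ℕ) :
    (x, (n : OnePoint ℕ)) ∈ plankJ := fun h => OnePoint.coe_ne_infty n (Prod.ext_iff.1 h).2

theorem coe_mk_mem_plankJ (a : OmegaOne) (y : OnePoint ℕ) :
    ((a : OnePoint OmegaOne), y) ∈ plankJ := fun h => OnePoint.coe_ne_infty a (Prod.ext_iff.1 h).1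

/-- Along the points `(∞, n)` of the plank every continuous real-valued function converges. -/
theorem exists_tendsto_of_continuous_plankJ {F : plankJ → ℝ} (hF : Continuous F) :
    ∃ c, Tendsto (fun n : ℕ => F ⟨(OnePoint.infty, n), mk_coe_mem_plankJ _ n⟩) atTop (𝓝 c) := by
  have hcount : (⋃ n : ℕ, {a : OmegaOne | F ⟨((a : OnePoint OmegaOne), n), mk_coe_mem_plankJ a n⟩ ≠
      F ⟨(OnePoint.infty, n), mk_coe_mem_plankJ _ n⟩}).Countable :=
    countable_iUnion fun n => countable_setOf_ne_infty
      (f := fun x => F ⟨(x, n), mk_coe_mem_plankJ x n⟩) (hF.comp (by fun_prop))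
  -- Uncountability of ω₁ gives one `a` outside all the countable exceptional sets; along it the
  -- values converge by continuity at (a, ∞).
  obtain ⟨a, ha⟩ := (ne_univ_iff_exists_notMem _).1 fun h =>
    not_countable_univ (α := OmegaOne) (hcount.mono h.ge)
  simp only [mem_iUnion, mem_ofPred_eq, not_exists, not_not] at ha
  simp only [← ha]
  let G : OnePoint ℕ → ℝ := fun y => F ⟨((a : OnePoint OmegaOne), y), coe_mk_mem_plankJ a y⟩
  have hG : Continuous G := hF.comp (by fun_prop)
  refine ⟨G OnePoint.infty, (hG.tendsto OnePoint.infty).comp ?_⟩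
  exact Nat.cofinite_eq_atTop ▸ tendsto_coe_onePoint_cofinite

theorem not_isRealcompact_plankJ : ¬ IsRealcompact plankJ := by
  rintro ⟨ι, e, he⟩
  choose c hc using fun i : ι =>
    exists_tendsto_of_continuous_plankJ ((continuous_apply i).comp he.continuous)
  let p : ℕ → plankJ := fun n => ⟨(OnePoint.infty, n), mk_coe_mem_plankJ _ n⟩
  have hlim : Tendsto (e ∘ p) atTop (𝓝 c) := tendsto_pi_nhds.2 hc
  -- A closed range forces the points (∞, n) to converge within the plank, but their only limit in
  -- the full product is the removed corner.
  obtain ⟨v, rfl⟩ := he.isClosed_range.mem_of_tendsto hlim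
    (Eventually.of_forall fun n => mem_range_self _)
  have hv : Tendsto (fun n => (p n : OnePoint OmegaOne × OnePoint ℕ)) atTop (𝓝 v) :=
    (continuous_subtype_val.tendsto v).comp (he.isInducing.tendsto_nhds_iff.2 hlim)
  have hinf : Tendsto (fun n => (p n : OnePoint OmegaOne × OnePoint ℕ)) atTop
      (𝓝 (OnePoint.infty, OnePoint.infty)) :=
    tendsto_const_nhds.prodMk_nhds (Nat.cofinite_eq_atTop ▸ tendsto_coe_onePoint_cofinite)
  exact v.2 (tendsto_nhds_unique hv hinf)

/-- Every point has an isolated coordinate; fixing it gives an open slice homeomorphic to βω₀ or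
βω₁. -/
theorem extremallyDisconnected_plankV : ExtremallyDisconnected plankV := by
  refine .of_isOpenEmbedding fun v => ?_
  obtain ⟨⟨x, y⟩, hv⟩ := v
  have hv' : x ∈ range stoneCechUnit ∨ y ∈ range stoneCechUnit := by
    simpa only [plankV, remainder, mem_compl_iff, mem_prod, not_and_or, not_not] using hv
  rcases hv' with ⟨a, rfl⟩ | ⟨n, rfl⟩
  · refine ⟨StoneCech ℕ, inferInstance, extremallyDisconnected_stoneCech,
      fun y => ⟨(stoneCechUnit a, y), fun h => h.1 ⟨a, rfl⟩⟩, ?_, y, rfl⟩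
    refine .of_continuous_injective_isOpenMap (by fun_prop) (fun y z h => congrArg (fun v => v.1.2) h) ?_
    intro W hW
    refine isOpen_induced_iff.2
      ⟨_, (isOpen_singleton_stoneCechUnit a).prod hW, ?_⟩
    ext ⟨⟨x, z⟩, h⟩
    simp only [mem_preimage, mem_prod, mem_singleton_iff, mem_image, Subtype.ext_iff,
      Prod.ext_iff]
    grind
  · refine ⟨StoneCech OmegaOne, inferInstance, extremallyDisconnected_stoneCech,
      fun x => ⟨(x, stoneCechUnit n), fun h => h.2 ⟨n, rfl⟩⟩, ?_, x, rfl⟩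
    refine .of_continuous_injective_isOpenMap (by fun_prop) (fun y z h => congrArg (fun v => v.1.1) h) ?_
    intro W hW
    refine isOpen_induced_iff.2
      ⟨_, hW.prod (isOpen_singleton_stoneCechUnit n), ?_⟩
    ext ⟨⟨x, z⟩, h⟩
    simp only [mem_preimage, mem_prod, mem_singleton_iff, mem_image, Subtype.ext_iff,
      Prod.ext_iff]
    grind

/-- The restriction of the product map to the planks. -/
noncomputable def plankMap (x : plankV) : plankJ :=
  ⟨productMap x, by
    rw [← mem_preimage, productMap_preimage_plankJ]
    exact x.2⟩

/-- Properness survives restriction because `plankV` is the full preimage of `plankJ`. -/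
theorem isProperMap_plankMap : IsProperMap plankMap := by
  have h := continuous_productMap.isProperMap.restrictPreimage plankJ
  exact h.comp (Homeomorph.setCongr productMap_preimage_plankJ.symm).isProperMap

theorem plankMap_surjective : Function.Surjective plankMap := by
  rintro ⟨y, hy⟩
  obtain ⟨x, rfl⟩ := productMap_surjective y
  exact ⟨⟨x, productMap_preimage_plankJ ▸ hy⟩, rfl⟩

/-- The points of `ω₁ × ω₀` in the plank `𝕍`. -/
def plankUnit (d : OmegaOne × ℕ) : plankV :=
  ⟨Prod.map stoneCechUnit stoneCechUnit d, fun h => h.1 ⟨d.1, rfl⟩⟩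

theorem denseRange_plankUnit : DenseRange plankUnit := by
  intro v
  rw [closure_subtype, ← range_comp]
  exact denseRange_unit_prod _

theorem isIrreducibleMap_plankMap : IsIrreducibleMap plankMap :=
  .of_denseRange isProperMap_plankMap.continuous plankMap_surjective denseRange_plankUnit
    fun d x h => Subtype.ext (eq_of_productMap_eq d x (congrArg Subtype.val h))

theorem isAbsolute_plankMap : IsAbsolute plankMap :=
  ⟨inferInstance, extremallyDisconnected_plankV, isProperMap_plankMap.isPerfectMap,
    isIrreducibleMap_plankMap⟩

theorem isOpen_singleton_plankMap_plankUnit (d : OmegaOne × ℕ) :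
    IsOpen {plankMap (plankUnit d)} := by
  have h := ((isOpen_singleton_coe_onePoint d.1).prod (isOpen_singleton_coe_onePoint d.2)).preimage
    (continuous_subtype_val (p := (· ∈ plankJ)))
  convert h using 1
  ext x
  simp [Subtype.ext_iff, plankMap, plankUnit, productMap, Prod.ext_iff]

theorem plankMap_comp_plankUnit_injective : Function.Injective (plankMap ∘ plankUnit) := by
  intro a b h
  simpa [plankMap, plankUnit, productMap, Prod.ext_iff] using h

end Planks

theorem mainTheorem7 :
    -- The natural maps and their product are perfect and irreducible (in particular onto).
    (IsPerfectMap (naturalMap OmegaOne) ∧ IsIrreducibleMap (naturalMap OmegaOne)) ∧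
    (IsPerfectMap (naturalMap ℕ) ∧ IsIrreducibleMap (naturalMap ℕ)) ∧
    (IsPerfectMap productMap ∧ IsIrreducibleMap productMap) ∧
    -- Both planks are Tychonoff; the first is realcompact, the second is not.
    T35Space plankV ∧ T35Space plankJ ∧
    IsRealcompact plankV ∧ ¬ IsRealcompact plankJ ∧
    -- The product map restricts to a perfect map of one plank onto the other.
    productMap ⁻¹' plankJ = plankV ∧
    (∃ f : plankV → plankJ,
      (∀ x : plankV, (f x : OnePoint OmegaOne × OnePoint ℕ) = productMap x) ∧
      IsPerfectMap f ∧ Function.Surjective f ∧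
      -- The restriction makes the first plank the absolute of the second, which is unique.
      IsAbsolute f ∧
      ∀ (Z : Type) [TopologicalSpace Z] (g : Z → plankJ), IsAbsolute g →
        ∃ h : plankV ≃ₜ Z, ∀ x, g (h x) = f x) ∧
    ExtremallyDisconnected plankV ∧
    -- Perfect surjections need not preserve realcompactness.
    ¬ (∀ (X Y : Type) [TopologicalSpace X] [TopologicalSpace Y] [T35Space X] [T35Space Y]
        (f : X → Y), IsPerfectMap f → Function.Surjective f → IsRealcompact X →
          IsRealcompact Y) := by
  refine ⟨⟨continuous_naturalMap.isProperMap.isPerfectMap, isIrreducibleMap_naturalMap⟩,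
    ⟨continuous_naturalMap.isProperMap.isPerfectMap, isIrreducibleMap_naturalMap⟩,
    ⟨continuous_productMap.isProperMap.isPerfectMap,
      .of_denseRange continuous_productMap productMap_surjective denseRange_unit_prod
        eq_of_productMap_eq⟩,
    inferInstance, inferInstance, isRealcompact_plankV, not_isRealcompact_plankJ,
    productMap_preimage_plankJ,
    ⟨plankMap, fun _ => rfl, isProperMap_plankMap.isPerfectMap, plankMap_surjective,
      isAbsolute_plankMap, fun Z _ g hg => ?_⟩,
    extremallyDisconnected_plankV, fun h => ?_⟩
  · exact isAbsolute_plankMap.exists_homeomorph hg isOpen_singleton_plankMap_plankUnit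
      plankMap_comp_plankUnit_injective
      (plankMap_surjective.denseRange.comp denseRange_plankUnit isProperMap_plankMap.continuous)
  · exact not_isRealcompact_plankJ (h plankV plankJ plankMap isProperMap_plankMap.isPerfectMap
      plankMap_surjective isRealcompact_plankV)
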